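/- Let $T>0$, $\xi\in\mathbb{R}^n$, let $U\subset\mathbb{R}^m$ be connected, compact and non-empty, and let $f:[0,T]\times\mathbb{R}^n\times\mathbb{R}^m\to\mathbb{R}^n$ and $\Psi:\mathbb{R}^n\to\mathbb{R}$ be such that $\Psi$ is differentiable on $\mathbb{R}^n$, $f$ is differentiable in $x$ and in $u$ at every point of $[0,T]\times\mathbb{R}^n\times U$, and, for some $L>0$, $\Psi$ and $\nabla\Psi$ are $L$-Lipschitz on $\mathbb{R}^n$ and $f$, $\partial f/\partial x$, $\partial f/\partial u$ are $L$-Lipschitz on $[0,T]\times\mathbb{R}^n\times U$, in the sense that $\|g(t_1,x_1,u_1)-g(t_2,x_2,u_2)\|\le L(|t_1-t_2|+\|x_1-x_2\|+\|u_1-u_2\|)$ for $g=f,\ \partial f/\partial x,\ \partial f/\partial u$ (Euclidean norms and the induced operator norms). A relaxed input is a family $\mu=(\mu_t)_{t\in[0,T]}$ of Borel probability measures on $\mathbb{R}^m$ such that $t\mapsto\mu_t(B)$ is Lebesgue measurable for every Borel set $B$ and $\operatorname{supp}\mu_t\subset U$ for a.e. $t$. All differential equations below are understood in the Carathéodory sense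 (equivalently, in integral form). Let $\mu$ be a relaxed input and let $x=x^{(\mu)}$ be its trajectory, $$\dot x(t)=\int_{\mathbb{R}^m} f(t,x(t),u)\,d\mu_t(u),\qquad x(0)=\xi .$$ An admissible variation of $\mu$ is a family $\delta\mu=(\delta\mu_t)_{t\in[0,T]}$ of finite signed Borel measures on $\mathbb{R}^m$ such that $t\mapsto\delta\mu_t(B)$ is Lebesgue measurable for every Borel set $B$ and, for a.e. $t\in[0,T]$, $$\operatorname{supp}(\delta\mu_t+\mu_t)\subset U,\qquad \delta\mu_t+\mu_t\ge 0,\qquad \int_{\mathbb{R}^m} d\delta\mu_t=0 .$$ Define $$\theta_l(x,\mu)=\min_{(\delta x,\delta\mu)}\ \nabla\Psi(x(T))^{T}\,\delta x(T),$$ the minimum being over all pairs $(\delta x,\delta\mu)$ such that $\delta\mu$ is an admissible variation of $\mu$ and $$\dot{\delta x}(t)=\Big(\int_{\mathbb{R}^m}\frac{\partial f}{\partial x}(t,x(t),u)\,d\mu_t(u)\Big)\delta x(t)+\int_{\mathbb{R}^m} f(t,x(t),u)\,d\delta\mu_t(u),\qquad \delta x(0)=0 .$$ Let $p$ be the costate,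 that is, the solution on $[0,T]$ of $$\dot p(t)=-\Big(\int_{\mathbb{R}^m}\frac{\partial f}{\partial x}(t,x(t),u)^{T}\,d\mu_t(u)\Big)p(t),\qquad p(T)=\nabla\Psi(x(T)),$$ and define $$\theta_h(x,\mu)=\min_{\delta\mu}\ \int_0^T H(t,x(t),\delta\mu_t,p(t))\,dt,\qquad H(t,x,\nu,p)=p^{T}\int_{\mathbb{R}^m} f(t,x,u)\,d\nu(u),$$ the minimum being over all admissible variations $\delta\mu$ of $\mu$. Then the optimality functions $\theta_l$ and $\theta_h$ are equivalent: for every such pair $(x^{(\mu)},\mu)$, the costate exists, both minima are attained, $\theta_l(x,\mu)=\theta_h(x,\mu)$, and the minimizers are the same. That is, the variations $\delta\mu$ that occur in minimizers $(\delta x,\delta\mu)$ of the first problem are exactly the minimizers of the second, and a pair $(\delta x,\delta\mu)$ minimizes the first problem if and only if $\delta\mu$ minimizes the second one and $\delta x$ solves the linearized equation for $\delta\mu$. -/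

import Mathlib

open MeasureTheory Set

noncomputable section

/-- The data of a relaxed optimal control problem with state space `ℝⁿ` and input space `ℝᵐ`:
time horizon `[0, T]`, input set `U`, initial state `ξ`, vector field `f t x u` and final cost
`Ψ`. -/
structure RelaxedProblem (n m : ℕ) where
  T : ℝ
  U : Set (EuclideanSpace ℝ (Fin m))
  ξ : EuclideanSpace ℝ (Fin n)
  f : ℝ → EuclideanSpace ℝ (Fin n) → EuclideanSpace ℝ (Fin m) → EuclideanSpace ℝ (Fin n)
  Ψ : EuclideanSpace ℝ (Fin n) → ℝ

namespace RelaxedProblem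

variable {n m : ℕ}

/-- The Jacobian `∂f/∂x (t, x, u)`, as a continuous linear map. -/
def dfdx (P : RelaxedProblem n m) (t : ℝ) (x : EuclideanSpace ℝ (Fin n))
    (u : EuclideanSpace ℝ (Fin m)) : EuclideanSpace ℝ (Fin n) →L[ℝ] EuclideanSpace ℝ (Fin n) :=
  fderiv ℝ (fun y => P.f t y u) x

/-- The Jacobian `∂f/∂u (t, x, u)`, as a continuous linear map. -/
def dfdu (P : RelaxedProblem n m) (t : ℝ) (x : EuclideanSpace ℝ (Fin n))
    (u : EuclideanSpace ℝ (Fin m)) : EuclideanSpace ℝ (Fin m) →L[ℝ] EuclideanSpace ℝ (Fin n) :=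
  fderiv ℝ (fun v => P.f t x v) u

/-- `f` and `Ψ` are Lipschitz continuously differentiable (on `[0, T] × ℝⁿ × U` and on `ℝⁿ`):
the functions and their first derivatives in `x` and `u` are Lipschitz. All norms are Euclidean
norms and the operator norms that they induce. -/
def LipschitzC1 (P : RelaxedProblem n m) : Prop :=
  Differentiable ℝ P.Ψ ∧
  (∀ t ∈ Icc 0 P.T, ∀ x, ∀ u ∈ P.U,
    DifferentiableAt ℝ (fun y => P.f t y u) x ∧ DifferentiableAt ℝ (fun v => P.f t x v) u) ∧
  ∃ L : ℝ, 0 < L ∧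
    (∀ x₁ x₂, |P.Ψ x₁ - P.Ψ x₂| ≤ L * ‖x₁ - x₂‖) ∧
    (∀ x₁ x₂, ‖gradient P.Ψ x₁ - gradient P.Ψ x₂‖ ≤ L * ‖x₁ - x₂‖) ∧
    ∀ t₁ ∈ Icc 0 P.T, ∀ t₂ ∈ Icc 0 P.T, ∀ x₁ x₂, ∀ u₁ ∈ P.U, ∀ u₂ ∈ P.U,
      ‖P.f t₁ x₁ u₁ - P.f t₂ x₂ u₂‖ ≤ L * (|t₁ - t₂| + ‖x₁ - x₂‖ + ‖u₁ - u₂‖) ∧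
      ‖P.dfdx t₁ x₁ u₁ - P.dfdx t₂ x₂ u₂‖ ≤ L * (|t₁ - t₂| + ‖x₁ - x₂‖ + ‖u₁ - u₂‖) ∧
      ‖P.dfdu t₁ x₁ u₁ - P.dfdu t₂ x₂ u₂‖ ≤ L * (|t₁ - t₂| + ‖x₁ - x₂‖ + ‖u₁ - u₂‖)

/-- `μ` is a relaxed input: `t ↦ μ_t` is (Lebesgue) measurable on `[0, T]`, and
`supp μ_t ⊆ U` for almost every `t ∈ [0, T]`. -/
def IsRelaxedInput (P : RelaxedProblem n m)
    (μ : ℝ → ProbabilityMeasure (EuclideanSpace ℝ (Fin m))) : Prop :=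
  (∀ B, MeasurableSet B → AEMeasurable
    (fun t => (μ t : Measure (EuclideanSpace ℝ (Fin m))) B) (volume.restrict (Icc 0 P.T))) ∧
  ∀ᵐ t ∂(volume.restrict (Icc 0 P.T)),
    (μ t : Measure (EuclideanSpace ℝ (Fin m))).support ⊆ P.U

/-- `x` is, on `[0, T]`, a trajectory of the relaxed input `μ`: the (Carathéodory) solution of
`x' (t) = ∫ f (t, x t, u) dμ_t(u)`, `x 0 = ξ`, in integral form. -/
def IsTrajectory (P : RelaxedProblem n m)
    (μ : ℝ → ProbabilityMeasure (EuclideanSpace ℝ (Fin m)))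
    (x : ℝ → EuclideanSpace ℝ (Fin n)) : Prop :=
  IntervalIntegrable
    (fun s => ∫ u, P.f s (x s) u ∂(μ s : Measure (EuclideanSpace ℝ (Fin m)))) volume 0 P.T ∧
  ∀ t ∈ Icc 0 P.T, x t = P.ξ +
    ∫ s in (0 : ℝ)..t, ∫ u, P.f s (x s) u ∂(μ s : Measure (EuclideanSpace ℝ (Fin m)))

/-- `p` is, on `[0, T]`, a costate along `(x, μ)`: the (Carathéodory) solution of
`p' (t) = - (∫ (∂f/∂x (t, x t, u))ᵀ dμ_t(u)) (p t)`, `p T = ∂Ψ/∂x (x T)`, in integral form. -/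
def IsCostate (P : RelaxedProblem n m)
    (x : ℝ → EuclideanSpace ℝ (Fin n))
    (μ : ℝ → ProbabilityMeasure (EuclideanSpace ℝ (Fin m)))
    (p : ℝ → EuclideanSpace ℝ (Fin n)) : Prop :=
  IntervalIntegrable
    (fun s => (∫ u, ContinuousLinearMap.adjoint (P.dfdx s (x s) u)
      ∂(μ s : Measure (EuclideanSpace ℝ (Fin m)))) (p s)) volume 0 P.T ∧
  ∀ t ∈ Icc 0 P.T, p t = gradient P.Ψ (x P.T) +
    ∫ s in t..P.T, (∫ u, ContinuousLinearMap.adjoint (P.dfdx s (x s) u)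
      ∂(μ s : Measure (EuclideanSpace ℝ (Fin m)))) (p s)

/-- `δμ` is an admissible variation of the relaxed input `μ`: it is a (Lebesgue) measurable
family of signed measures, and for almost every `t ∈ [0, T]`, `supp (δμ_t + μ_t) ⊆ U`,
`δμ_t + μ_t ≥ 0` and `∫ dδμ_t = 0`. -/
def IsVariation (P : RelaxedProblem n m)
    (μ : ℝ → ProbabilityMeasure (EuclideanSpace ℝ (Fin m)))
    (δμ : ℝ → SignedMeasure (EuclideanSpace ℝ (Fin m))) : Prop :=
  (∀ B, MeasurableSet B → AEMeasurable (fun t => δμ t B) (volume.restrict (Icc 0 P.T))) ∧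
  ∀ᵐ t ∂(volume.restrict (Icc 0 P.T)),
    (δμ t + (μ t : Measure (EuclideanSpace ℝ (Fin m))).toSignedMeasure).variation.support ⊆ P.U ∧
    0 ≤ δμ t + (μ t : Measure (EuclideanSpace ℝ (Fin m))).toSignedMeasure ∧
    δμ t univ = 0

/-- `δx` is, on `[0, T]`, the (Carathéodory) solution, in integral form, of the dynamics
linearized along `(x, μ)`: `δx' (t) = (∫ ∂f/∂x (t, x t, u) dμ_t(u)) (δx t) + ∫ f (t, x t, u) dδμ_t(u)`,
`δx 0 = 0`. -/
def IsLinearizedTrajectory (P : RelaxedProblem n m)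
    (x : ℝ → EuclideanSpace ℝ (Fin n))
    (μ : ℝ → ProbabilityMeasure (EuclideanSpace ℝ (Fin m)))
    (δμ : ℝ → SignedMeasure (EuclideanSpace ℝ (Fin m)))
    (δx : ℝ → EuclideanSpace ℝ (Fin n)) : Prop :=
  IntervalIntegrable
    (fun s => (∫ u, P.dfdx s (x s) u ∂(μ s : Measure (EuclideanSpace ℝ (Fin m)))) (δx s)
      + ∫ᵛ u, P.f s (x s) u ∂<•(δμ s)) volume 0 P.T ∧
  ∀ t ∈ Icc 0 P.T, δx t =
    ∫ s in (0 : ℝ)..t,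
      ((∫ u, P.dfdx s (x s) u ∂(μ s : Measure (EuclideanSpace ℝ (Fin m)))) (δx s)
        + ∫ᵛ u, P.f s (x s) u ∂<•(δμ s))

/-- The feasible set of the linearized problem: pairs `(δx, δμ)`. -/
def linFeasible (P : RelaxedProblem n m) (x : ℝ → EuclideanSpace ℝ (Fin n))
    (μ : ℝ → ProbabilityMeasure (EuclideanSpace ℝ (Fin m))) :
    Set ((ℝ → EuclideanSpace ℝ (Fin n)) × (ℝ → SignedMeasure (EuclideanSpace ℝ (Fin m)))) :=
  {z | P.IsVariation μ z.2 ∧ P.IsLinearizedTrajectory x μ z.2 z.1}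

/-- The cost `∂Ψ/∂x (x T)ᵀ δx T` of the linearized problem. -/
def linCost (P : RelaxedProblem n m) (x : ℝ → EuclideanSpace ℝ (Fin n))
    (z : (ℝ → EuclideanSpace ℝ (Fin n)) × (ℝ → SignedMeasure (EuclideanSpace ℝ (Fin m)))) : ℝ :=
  inner ℝ (gradient P.Ψ (x P.T)) (z.1 P.T)

/-- The optimality function `θ_l`: the optimal value of the linearized problem. -/
def thetaL (P : RelaxedProblem n m) (x : ℝ → EuclideanSpace ℝ (Fin n))
    (μ : ℝ → ProbabilityMeasure (EuclideanSpace ℝ (Fin m))) : ℝ :=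
  sInf (P.linCost x '' P.linFeasible x μ)

/-- The minimizers `(δx, δμ)` of the linearized problem. -/
def linMinimizers (P : RelaxedProblem n m) (x : ℝ → EuclideanSpace ℝ (Fin n))
    (μ : ℝ → ProbabilityMeasure (EuclideanSpace ℝ (Fin m))) :
    Set ((ℝ → EuclideanSpace ℝ (Fin n)) × (ℝ → SignedMeasure (EuclideanSpace ℝ (Fin m)))) :=
  {z ∈ P.linFeasible x μ | IsMinOn (P.linCost x) (P.linFeasible x μ) z}

/-- The Hamiltonian `H (t, x, ν, p) = pᵀ ∫ f (t, x, u) dν(u)` of a signed measure `ν`. -/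
def hamiltonian (P : RelaxedProblem n m) (t : ℝ) (x : EuclideanSpace ℝ (Fin n))
    (ν : SignedMeasure (EuclideanSpace ℝ (Fin m))) (p : EuclideanSpace ℝ (Fin n)) : ℝ :=
  inner ℝ p (∫ᵛ u, P.f t x u ∂<•ν)

/-- The feasible set of the Hamiltonian problem. -/
def hamFeasible (P : RelaxedProblem n m)
    (μ : ℝ → ProbabilityMeasure (EuclideanSpace ℝ (Fin m))) :
    Set (ℝ → SignedMeasure (EuclideanSpace ℝ (Fin m))) :=
  {δμ | P.IsVariation μ δμ}

/-- The cost `∫₀ᵀ H (t, x t, δμ_t, p t) dt` of the Hamiltonian problem. -/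
def hamCost (P : RelaxedProblem n m) (x p : ℝ → EuclideanSpace ℝ (Fin n))
    (δμ : ℝ → SignedMeasure (EuclideanSpace ℝ (Fin m))) : ℝ :=
  ∫ t in (0 : ℝ)..P.T, P.hamiltonian t (x t) (δμ t) (p t)

/-- The optimality function `θ_h`: the optimal value of the Hamiltonian problem, where `p` is the
costate along `(x, μ)`. -/
def thetaH (P : RelaxedProblem n m) (x : ℝ → EuclideanSpace ℝ (Fin n))
    (μ : ℝ → ProbabilityMeasure (EuclideanSpace ℝ (Fin m)))
    (p : ℝ → EuclideanSpace ℝ (Fin n)) : ℝ :=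
  sInf (P.hamCost x p '' P.hamFeasible μ)

/-- The minimizers `δμ` of the Hamiltonian problem. -/
def hamMinimizers (P : RelaxedProblem n m) (x : ℝ → EuclideanSpace ℝ (Fin n))
    (μ : ℝ → ProbabilityMeasure (EuclideanSpace ℝ (Fin m)))
    (p : ℝ → EuclideanSpace ℝ (Fin n)) :
    Set (ℝ → SignedMeasure (EuclideanSpace ℝ (Fin m))) :=
  {δμ ∈ P.hamFeasible μ | IsMinOn (P.hamCost x p) (P.hamFeasible μ) δμ}

end RelaxedProblem

end

/-! The two problems have the same cost, written in two ways. Let `A(t)` be the `μ_t`-average of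
`∂f/∂x` and `b(t) = ∫ f dδμ_t`. If `δx' = A δx + b` and `p' = -Aᵀ p`, then `⟨δx, p⟩' = ⟨b, p⟩`,
because the terms with `A` cancel. Integrating with `δx(0) = 0` and `p(T) = ∇Ψ(x(T))` gives
`∇Ψ(x(T))ᵀ δx(T) = ∫₀ᵀ H dt` (`linCost_eq_hamCost`). The linear cost thus depends on `δμ` alone. As
every admissible `δμ` has a linearized trajectory, values and minimizers of the two problems
correspond. Uniqueness of `δx` or of `p` plays no role.

Existence of `p` and `δx` is Carathéodory theory for linear equations with bounded measurable
coefficients (`exists_eq_integral_linear`). The coefficients are averages over `μ_t`, and their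
measurability in `t` comes from replacing `μ` by a Markov kernel off a null set
(`exists_markovKernel_ae_eq`).

It remains to attain the Hamiltonian minimum. An admissible variation is `ν_t - μ_t` with `ν_t` a
probability measure carried by `U`, so the cost is bounded below by minimizing `⟨p(t), f(t, x(t),
u)⟩` over `u ∈ U` at each time. A measurable choice `s(t)` of minimizers
(`exists_measurable_argmin`) makes the Dirac family `δ_{s(t)} - μ_t` optimal. -/

/-! ### Measurable selection and measurability of parametric averages -/

/-- `U` is a continuous image of the Cantor set, whose order allows a canonical choice: the least
Cantor parameter of a minimizer is a lower semicontinuous function of `t ∈ I`, hence measurable. -/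
theorem exists_measurable_argmin {E : Type*} [MetricSpace E] [MeasurableSpace E] [BorelSpace E]
    {I : Set ℝ} {U : Set E} (hI : IsCompact I) (hU : IsCompact U) (hne : U.Nonempty)
    {g : ℝ → E → ℝ} (hg : ContinuousOn (Function.uncurry g) (I ×ˢ U)) :
    ∃ s : ℝ → E, Measurable s ∧ (∀ t, s t ∈ U) ∧ ∀ t ∈ I, ∀ u ∈ U, g t (s t) ≤ g t u := by
  have : Nonempty U := hne.to_subtype
  have : CompactSpace U := isCompact_iff_compactSpace.1 hU
  have : CompactSpace cantorSet := isCompact_iff_compactSpace.1 isCompact_cantorSet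
  obtain ⟨φ, hφ, hφs⟩ := exists_nat_bool_continuous_surjective_of_compact U
  set ψ : cantorSet → U := φ ∘ cantorSetHomeomorphNatToBool
  have hψc : Continuous ψ := hφ.comp cantorSetHomeomorphNatToBool.continuous
  have hψs : Function.Surjective ψ := hφs.comp cantorSetHomeomorphNatToBool.surjective
  -- `S` is the graph of the argmin correspondence, pulled back to the Cantor set; `V t` below is
  -- its slice at `t`, seen in `ℝ`.
  let S : Set (ℝ × cantorSet) :=
    ⋂ u : U, {q ∈ I ×ˢ univ | g q.1 (ψ q.2) ≤ g q.1 u}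
  have hScl : IsClosed S := by
    refine isClosed_iInter fun u => ?_
    refine (hI.isClosed.prod isClosed_univ).isClosed_le ?_ ?_
    · exact hg.comp (f := fun q : ℝ × cantorSet => (q.1, (ψ q.2 : E)))
        (by fun_prop) (fun q hq => ⟨hq.1, (ψ q.2).2⟩)
    · exact hg.comp (f := fun q : ℝ × cantorSet => (q.1, (u : E)))
        (by fun_prop) (fun q hq => ⟨hq.1, u.2⟩)
  have hS : IsCompact S := by
    refine (hI.prod isCompact_univ).of_isClosed_subset hScl fun q hq => ?_
    exact (mem_iInter.1 hq hne.to_subtype.some).1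
  let V : ℝ → Set ℝ := fun t => (fun c : cantorSet => (c : ℝ)) '' {c | (t, c) ∈ S}
  have hVc : ∀ t, IsCompact (V t) := fun t =>
    ((hScl.preimage (by fun_prop : Continuous fun c : cantorSet => (t, c))).isCompact).image
      continuous_subtype_val
  have hVn : ∀ t ∈ I, (V t).Nonempty := by
    intro t ht
    obtain ⟨v, hv, hmin⟩ := hU.exists_isMinOn hne
      (hg.comp (f := fun u => (t, u)) (by fun_prop) fun u hu => ⟨ht, hu⟩)
    obtain ⟨c, hc⟩ := hψs ⟨v, hv⟩
    refine ⟨c, c, mem_iInter.2 fun u => ⟨⟨ht, mem_univ _⟩, ?_⟩, rfl⟩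
    simpa [hc] using hmin u.2
  have hVe : ∀ t ∉ I, V t = ∅ := by
    intro t ht
    simp only [V, image_eq_empty]
    refine eq_empty_of_forall_notMem fun c hc => ht ?_
    exact (mem_iInter.1 hc hne.to_subtype.some).1.1
  have hmem : ∀ t ∈ I, sInf (V t) ∈ V t := fun t ht => (hVc t).sInf_mem (hVn t ht)
  have hcantor : ∀ t, sInf (V t) ∈ cantorSet := by
    intro t
    by_cases ht : t ∈ I
    · obtain ⟨c, -, hc⟩ := hmem t ht
      rw [← hc]; exact c.2
    -- Off `I` the slice is empty and its infimum is the default `0`, which happens to lie in the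
    -- Cantor set.
    · rw [hVe t ht, Real.sInf_empty]; exact zero_mem_cantorSet
  have hmeas : Measurable fun t => sInf (V t) := by
    refine measurable_of_Iic fun a => ?_
    -- Within `I` a sublevel set is the projection of a compact set, because the infimum is
    -- attained; off `I` the function is the constant `0`.
    have : (fun t => sInf (V t)) ⁻¹' Iic a =
        Prod.fst '' (S ∩ {q | (q.2 : ℝ) ≤ a}) ∪ (Iᶜ ∩ {_t | (0 : ℝ) ≤ a}) := by
      ext t
      by_cases ht : t ∈ I
      · simp only [mem_preimage, mem_Iic, mem_union, mem_inter_iff, mem_compl_iff, ht,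
          not_true_eq_false, false_and, or_false]
        constructor
        · intro h
          obtain ⟨c, hc, hc'⟩ := hmem t ht
          exact ⟨(t, c), ⟨hc, by simpa [hc'] using h⟩, rfl⟩
        · rintro ⟨⟨t', c⟩, ⟨hc, hca⟩, rfl⟩
          exact (csInf_le (hVc _).bddBelow ⟨c, hc, rfl⟩).trans hca
      · simp only [mem_preimage, mem_Iic, hVe t ht, Real.sInf_empty, mem_union, mem_inter_iff,
          mem_compl_iff, ht, not_false_eq_true, true_and, mem_ofPred_eq]
        constructor
        · exact Or.inr
        · rintro (⟨⟨t', c⟩, ⟨hc, -⟩, rfl⟩ | h)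
          · exact absurd (mem_iInter.1 hc hne.to_subtype.some).1.1 ht
          · exact h
    rw [this]
    refine MeasurableSet.union ?_ (hI.isClosed.measurableSet.compl.inter (by simp))
    exact ((hS.inter_right (isClosed_le (by fun_prop) (by fun_prop))).image
      continuous_fst).isClosed.measurableSet
  refine ⟨fun t => ψ ⟨sInf (V t), hcantor t⟩, ?_, fun t => (ψ _).2, fun t ht u hu => ?_⟩
  · exact measurable_subtype_coe.comp (hψc.measurable.comp (hmeas.subtype_mk))
  · obtain ⟨c, hc, hc'⟩ := hmem t ht
    have : (⟨sInf (V t), hcantor t⟩ : cantorSet) = c := Subtype.ext hc'.symm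
    simp only [this]
    exact (mem_iInter.1 hc ⟨u, hu⟩).2

/-- A countable algebra generates the Borel sets, so a single null set carries all exceptions to
measurability on that algebra. Putting a fixed Dirac mass there gives a genuine kernel, by the
π-system criterion. -/
theorem exists_markovKernel_ae_eq {E : Type*} [TopologicalSpace E] [SecondCountableTopology E]
    [MeasurableSpace E] [BorelSpace E] [Nonempty E] {ρ : Measure ℝ} {μ : ℝ → Measure E}
    (hμ : ∀ B, MeasurableSet B → AEMeasurable (fun t => μ t B) ρ)
    (hprob : ∀ᵐ t ∂ρ, IsProbabilityMeasure (μ t)) :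
    ∃ κ : ProbabilityTheory.Kernel ℝ E, ProbabilityTheory.IsMarkovKernel κ ∧
      ∀ᵐ t ∂ρ, κ t = μ t := by
  classical
  let C := generateSetAlgebra (TopologicalSpace.countableBasis E)
  have hC : C.Countable :=
    countable_generateSetAlgebra (TopologicalSpace.countable_countableBasis E)
  have hgen : ‹MeasurableSpace E› = MeasurableSpace.generateFrom C := by
    rw [generateFrom_generateSetAlgebra_eq, BorelSpace.measurable_eq (α := E),
      (TopologicalSpace.isBasis_countableBasis E).borel_eq_generateFrom]
  have hpi : IsPiSystem C := fun s hs t ht _ =>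
    (isSetAlgebra_generateSetAlgebra).inter_mem hs ht
  have hCm : ∀ B ∈ C, MeasurableSet B := fun B hB => by
    rw [hgen]; exact MeasurableSpace.measurableSet_generateFrom hB
  have hC' : Countable C := hC.to_subtype
  have hae : ∀ᵐ t ∂ρ, (∀ B : C, μ t B = (hμ B (hCm B B.2)).mk _ t) ∧
      IsProbabilityMeasure (μ t) :=
    (ae_all_iff.2 fun B : C => (hμ B (hCm B B.2)).ae_eq_mk).and hprob
  let N := toMeasurable ρ {t | ¬ ((∀ B : C, μ t B = (hμ B (hCm B B.2)).mk _ t) ∧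
      IsProbabilityMeasure (μ t))}
  have hN : MeasurableSet N := measurableSet_toMeasurable _ _
  have hN0 : ρ N = 0 := by rw [measure_toMeasurable]; exact hae
  have hgood : ∀ t ∉ N, (∀ B : C, μ t B = (hμ B (hCm B B.2)).mk _ t) ∧
      IsProbabilityMeasure (μ t) := fun t ht => by
    by_contra h
    exact ht (subset_toMeasurable ρ _ h)
  let e : E := Classical.arbitrary E
  let κ : ℝ → Measure E := fun t => if t ∈ N then Measure.dirac e else μ t
  have hκp : ∀ t, IsProbabilityMeasure (κ t) := fun t => by
    by_cases ht : t ∈ N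
    · simp only [κ, ht, if_true]; infer_instance
    · simp only [κ, ht, if_false]; exact (hgood t ht).2
  have hκm : Measurable κ := by
    refine Measurable.measure_of_isPiSystem_of_isProbabilityMeasure hgen hpi fun B hB => ?_
    have : (fun t => κ t B) =
        fun t => if t ∈ N then Measure.dirac e B else (hμ B (hCm B hB)).mk _ t := by
      ext t
      by_cases ht : t ∈ N
      · simp [κ, ht]
      · simp only [κ, ht, if_false]; exact (hgood t ht).1 ⟨B, hB⟩
    rw [this]
    exact Measurable.ite hN measurable_const (hμ B (hCm B hB)).measurable_mk
  refine ⟨⟨κ, hκm⟩, ⟨hκp⟩, ?_⟩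
  filter_upwards [measure_eq_zero_iff_ae_notMem.1 hN0] with t ht
  exact if_neg ht

/-- For a kernel and a jointly measurable integrand this is the measurability half of Fubini.
Nothing is known of `g` off `I ×ˢ U`, so it is cut off to zero there, which does not change the
integrals for almost every `t`. -/
theorem aestronglyMeasurable_integral_of_continuousOn {E F : Type*} [TopologicalSpace E]
    [SecondCountableTopology E] [T2Space E]
    [MeasurableSpace E] [BorelSpace E] [NormedAddCommGroup F] [NormedSpace ℝ F]
    {I : Set ℝ} {U : Set E} (hI : IsCompact I) (hU : IsCompact U)
    {g : ℝ → E → F} (hg : ContinuousOn (Function.uncurry g) (I ×ˢ U))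
    {μ : ℝ → Measure E}
    (hμ : ∀ B, MeasurableSet B → AEMeasurable (fun t => μ t B) (volume.restrict I))
    (hprob : ∀ᵐ t ∂(volume.restrict I), IsProbabilityMeasure (μ t))
    (hsupp : ∀ᵐ t ∂(volume.restrict I), μ t Uᶜ = 0) :
    AEStronglyMeasurable (fun t => ∫ u, g t u ∂(μ t)) (volume.restrict I) := by
  rcases isEmpty_or_nonempty E with hE | hE
  · simp only [integral_of_isEmpty]; exact aestronglyMeasurable_const
  obtain ⟨κ, hκ, hκμ⟩ := exists_markovKernel_ae_eq hμ hprob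
  have hIU : MeasurableSet (I ×ˢ U) := hI.measurableSet.prod hU.measurableSet
  have hG : StronglyMeasurable ((I ×ˢ U).indicator (Function.uncurry g)) := by
    borelize F
    classical
    refine stronglyMeasurable_iff_measurable_separable.2 ⟨?_, ?_⟩
    · rw [← piecewise_eq_indicator]
      exact hg.measurable_piecewise continuous_zero.continuousOn hIU
    · refine ((((hI.prod hU).image_of_continuousOn hg).isSeparable).union
        (finite_singleton (0 : F)).isSeparable).mono ?_
      rintro _ ⟨q, rfl⟩
      by_cases hq : q ∈ I ×ˢ U
      · exact Or.inl ⟨q, hq, (indicator_of_mem hq _).symm⟩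
      · exact Or.inr (indicator_of_notMem hq _)
  refine ⟨_, hG.integral_kernel_prod_right' (κ := κ), ?_⟩
  filter_upwards [hκμ, hsupp, ae_restrict_mem hI.measurableSet] with t h1 h2 h3
  rw [h1]
  refine integral_congr_ae ?_
  filter_upwards [measure_eq_zero_iff_ae_notMem.1 h2] with u hu
  have hu' : u ∈ U := by simpa using hu
  simp [indicator, h3, hu']

/-! ### Integral calculus and linear Carathéodory equations -/

/-- Product rule, in integral form, for the inner product of two primitives. -/
theorem integral_inner_add_inner_of_primitive {n : ℕ} {T : ℝ} (hT : 0 ≤ T)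
    {f g F G : ℝ → EuclideanSpace ℝ (Fin n)} {a b : EuclideanSpace ℝ (Fin n)}
    (hf : IntervalIntegrable f volume 0 T) (hg : IntervalIntegrable g volume 0 T)
    (hF : ∀ t ∈ Icc 0 T, F t = a + ∫ s in (0 : ℝ)..t, f s)
    (hG : ∀ t ∈ Icc 0 T, G t = b + ∫ s in (0 : ℝ)..t, g s) :
    ∫ t in (0 : ℝ)..T, (inner ℝ (f t) (G t) + inner ℝ (F t) (g t)) =
      inner ℝ (F T) (G T) - inner ℝ a b := by
  have hcoord : ∀ (h : ℝ → EuclideanSpace ℝ (Fin n)) (i : Fin n),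
      IntervalIntegrable h volume 0 T → IntervalIntegrable (fun t => h t i) volume 0 T :=
    fun h i hh => ((EuclideanSpace.proj (𝕜 := ℝ) i).integrable_comp hh.1 |> fun h1 =>
      ⟨h1, (EuclideanSpace.proj (𝕜 := ℝ) i).integrable_comp hh.2⟩)
  have hprim : ∀ (h H : ℝ → EuclideanSpace ℝ (Fin n)) (c : EuclideanSpace ℝ (Fin n)),
      IntervalIntegrable h volume 0 T →
      (∀ t ∈ Icc 0 T, H t = c + ∫ s in (0 : ℝ)..t, h s) →
      ∀ i, ∀ t ∈ Icc 0 T, H t i = c i + ∫ s in (0 : ℝ)..t, h s i := by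
    intro h H c hh hH i t ht
    rw [hH t ht]
    have := (EuclideanSpace.proj (𝕜 := ℝ) i).intervalIntegral_comp_comm
      (hh.mono_set (by rw [uIcc_of_le ht.1, uIcc_of_le hT]; exact Icc_subset_Icc_right ht.2) :
        IntervalIntegrable h volume 0 t)
    change ∫ s in (0 : ℝ)..t, h s i = (∫ s in (0 : ℝ)..t, h s) i at this
    simp [this]
  -- Primitives of integrable real functions are absolutely continuous, so integration by parts
  -- applies to them; the vector case is the sum over coordinates.
  have hscalar : ∀ (f g : ℝ → ℝ) (a b : ℝ), IntervalIntegrable f volume 0 T →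
      IntervalIntegrable g volume 0 T →
      IntervalIntegrable (fun t => f t * (b + ∫ s in (0 : ℝ)..t, g s)
        + (a + ∫ s in (0 : ℝ)..t, f s) * g t) volume 0 T ∧
      ∫ t in (0 : ℝ)..T, (f t * (b + ∫ s in (0 : ℝ)..t, g s)
        + (a + ∫ s in (0 : ℝ)..t, f s) * g t) =
        (a + ∫ s in (0 : ℝ)..T, f s) * (b + ∫ s in (0 : ℝ)..T, g s) - a * b := by
    intro f g a b hf hg
    have ac : ∀ (h : ℝ → ℝ) (c : ℝ), IntervalIntegrable h volume 0 T →
        AbsolutelyContinuousOnInterval (fun t => c + ∫ s in (0 : ℝ)..t, h s) 0 T := by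
      intro h c hh
      have h0 : AbsolutelyContinuousOnInterval (fun _ : ℝ => c) 0 T :=
        (LipschitzWith.const c).lipschitzOnWith.absolutelyContinuousOnInterval
      exact h0.add (hh.absolutelyContinuousOnInterval_intervalIntegral left_mem_uIcc)
    refine ⟨(hf.mul_continuousOn (ac g b hg).continuousOn).add
      (hg.continuousOn_mul (ac f a hf).continuousOn), ?_⟩
    have key := (ac f a hf).integral_deriv_mul_eq_sub (ac g b hg)
    simp only [intervalIntegral.integral_same, add_zero] at key
    rw [← key]
    refine intervalIntegral.integral_congr_ae ?_
    filter_upwards [hf.ae_hasDerivAt_integral, hg.ae_hasDerivAt_integral] with t h1 h2 ht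
    have ht' := uIoc_subset_uIcc ht
    rw [((h1 ht' 0 left_mem_uIcc).const_add a).deriv, ((h2 ht' 0 left_mem_uIcc).const_add b).deriv]
  have hs := fun i => hscalar (fun t => f t i) (fun t => g t i) (a i) (b i)
    (hcoord f i hf) (hcoord g i hg)
  have hFi := hprim f F a hf hF
  have hGi := hprim g G b hg hG
  calc ∫ t in (0 : ℝ)..T, (inner ℝ (f t) (G t) + inner ℝ (F t) (g t))
      = ∫ t in (0 : ℝ)..T, ∑ i, (f t i * (b i + ∫ s in (0 : ℝ)..t, g s i)
        + (a i + ∫ s in (0 : ℝ)..t, f s i) * g t i) := by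
        refine intervalIntegral.integral_congr fun t ht => ?_
        rw [uIcc_of_le hT] at ht
        simp only [PiLp.inner_apply, ← Finset.sum_add_distrib]
        refine Finset.sum_congr rfl fun i _ => ?_
        rw [← hFi i t ht, ← hGi i t ht]
        simp [mul_comm]
    _ = ∑ i, (F T i * G T i - a i * b i) := by
        rw [intervalIntegral.integral_finsetSum fun i _ => (hs i).1]
        refine Finset.sum_congr rfl fun i _ => ?_
        rw [(hs i).2, hFi i T ⟨hT, le_rfl⟩, hGi i T ⟨hT, le_rfl⟩]
    _ = _ := by
        simp [PiLp.inner_apply, Finset.sum_sub_distrib, mul_comm]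

/-- Existence of Carathéodory solutions of linear differential equations. -/
theorem exists_eq_integral_linear {E : Type*} [NormedAddCommGroup E] [NormedSpace ℝ E]
    [CompleteSpace E] {T : ℝ} (hT : 0 ≤ T) {A : ℝ → E →L[ℝ] E} {b : ℝ → E} {M : ℝ}
    (hA : AEStronglyMeasurable A volume) (hM : ∀ᵐ t, ‖A t‖ ≤ M) (hb : Integrable b volume)
    (y₀ : E) :
    ∃ y : ℝ → E, (∀ a c, IntervalIntegrable (fun s => A s (y s) + b s) volume a c) ∧
      ∀ t ∈ Icc 0 T, y t = y₀ + ∫ s in (0 : ℝ)..t, (A s (y s) + b s) := by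
  have hM0 : 0 ≤ M := by
    obtain ⟨t, ht⟩ := hM.exists
    exact (norm_nonneg _).trans ht
  have hAi : ∀ y : ℝ → E, Continuous y → ∀ a c, IntervalIntegrable (fun s => A s (y s)) volume a c := by
    intro y hy a c
    have h1 : IntervalIntegrable (fun s => M * ‖y s‖) volume a c :=
      (continuous_const.mul hy.norm).intervalIntegrable a c
    refine h1.mono_fun ?_ ?_
    · exact ((ContinuousLinearMap.id ℝ (E →L[ℝ] E)).aestronglyMeasurable_comp₂ hA
        hy.aestronglyMeasurable).restrict
    · refine ae_restrict_of_ae (hM.mono fun s hs => ?_)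
      refine (ContinuousLinearMap.le_opNorm _ _).trans ((mul_le_mul_of_nonneg_right hs
        (norm_nonneg _)).trans (le_abs_self _))
  have hi : ∀ y : ℝ → E, Continuous y →
      ∀ a c, IntervalIntegrable (fun s => A s (y s) + b s) volume a c :=
    fun y hy a c => (hAi y hy a c).add hb.intervalIntegrable
  -- With the substitution `y = exp (K t) • z` the Picard operator has Lipschitz constant at most `M
  -- / K ≤ 1 / 2` on all of `[0, T]`. The `+ 1` keeps `K` positive when `M = 0`.
  set K : ℝ := 2 * (M + 1) with hK
  have hK0 : 0 < K := by positivity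
  let X := C(Icc (0 : ℝ) T, E)
  let ext : X → ℝ → E := fun z t => Real.exp (K * t) • z (projIcc 0 T hT t)
  have hext : ∀ z, Continuous (ext z) := fun z => by
    have := z.continuous.comp (continuous_projIcc (h := hT))
    exact (by fun_prop : Continuous fun t : ℝ => Real.exp (K * t)).smul this
  let Φ : X → X := fun z => ⟨fun t => Real.exp (-(K * t)) •
      (y₀ + ∫ s in (0 : ℝ)..t, (A s (ext z s) + b s)), by
    have h1 : Continuous fun t => ∫ s in (0 : ℝ)..t, (A s (ext z s) + b s) :=
      intervalIntegral.continuous_primitive (hi _ (hext z)) 0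
    have h2 := h1.comp (continuous_subtype_val (p := fun t => t ∈ Icc (0 : ℝ) T))
    exact (by fun_prop : Continuous fun t : Icc (0 : ℝ) T => Real.exp (-(K * t))).smul
      (continuous_const.add h2)⟩
  have hlip : LipschitzWith (1 / 2 : NNReal) Φ := by
    refine LipschitzWith.of_dist_le_mul fun z w => ?_
    rw [ContinuousMap.dist_le (by positivity)]
    intro t
    have ht := t.2
    have hsub : (∫ s in (0 : ℝ)..t, (A s (ext z s) + b s)) - ∫ s in (0 : ℝ)..t, (A s (ext w s) + b s)
        = ∫ s in (0 : ℝ)..t, A s (ext z s - ext w s) := by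
      rw [← intervalIntegral.integral_sub (hi _ (hext z) _ _) (hi _ (hext w) _ _)]
      refine intervalIntegral.integral_congr fun s _ => ?_
      simp
    have hbound : ‖∫ s in (0 : ℝ)..t, A s (ext z s - ext w s)‖ ≤
        ∫ s in (0 : ℝ)..t, M * dist z w * Real.exp (K * s) := by
      refine intervalIntegral.norm_integral_le_of_norm_le ht.1 ?_ ?_
      · filter_upwards [hM] with s hs _
        have : ext z s - ext w s = Real.exp (K * s) •
            (z (projIcc 0 T hT s) - w (projIcc 0 T hT s)) := (smul_sub _ _ _).symm
        rw [this]
        refine (ContinuousLinearMap.le_opNorm _ _).trans ?_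
        rw [norm_smul, Real.norm_eq_abs, abs_of_pos (Real.exp_pos _), ← dist_eq_norm, mul_assoc M,
          mul_comm (dist z w)]
        exact mul_le_mul hs (mul_le_mul_of_nonneg_left (ContinuousMap.dist_apply_le_dist _)
          (Real.exp_pos _).le) (by positivity) hM0
      · exact (by fun_prop : Continuous fun s : ℝ => M * dist z w * Real.exp (K * s)).intervalIntegrable
          _ _
    have hexp : ∫ s in (0 : ℝ)..t, M * dist z w * Real.exp (K * s) =
        M * dist z w * ((Real.exp (K * t) - 1) / K) := by
      rw [intervalIntegral.integral_const_mul]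
      congr 1
      rw [intervalIntegral.integral_comp_mul_left _ hK0.ne', integral_exp]
      simp [div_eq_inv_mul]
    have : dist (Φ z t) (Φ w t) = Real.exp (-(K * t)) *
        ‖∫ s in (0 : ℝ)..t, A s (ext z s - ext w s)‖ := by
      rw [← hsub, dist_eq_norm, ← abs_of_pos (Real.exp_pos (-(K * t))), ← Real.norm_eq_abs,
        ← norm_smul]
      congr 1
      have hΦ : ∀ z, Φ z t = Real.exp (-(K * t)) •
          (y₀ + ∫ s in (0 : ℝ)..t, (A s (ext z s) + b s)) := fun _ => rfl
      rw [hΦ, hΦ, ← smul_sub, add_sub_add_left_eq_sub]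
    rw [this]
    calc _ ≤ Real.exp (-(K * t)) * (M * dist z w * ((Real.exp (K * t) - 1) / K)) := by
          rw [← hexp]; gcongr
      _ = (M / K) * dist z w * (1 - Real.exp (-(K * t))) := by
          rw [Real.exp_neg]; field_simp
      _ ≤ (1 / 2) * dist z w * 1 := by
          have h1 : M / K ≤ 1 / 2 := by rw [div_le_div_iff₀ hK0 two_pos]; linarith
          have h2 : Real.exp (-(K * t)) ≤ 1 :=
            Real.exp_le_one_iff.2 (neg_nonpos.2 (mul_nonneg hK0.le ht.1))
          have h3 := Real.exp_pos (-(K * t))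
          exact mul_le_mul (mul_le_mul_of_nonneg_right h1 dist_nonneg) (by linarith)
            (by linarith) (by positivity)
      _ = _ := by simp
  have hc : ContractingWith (1 / 2 : NNReal) Φ := ⟨by norm_num, hlip⟩
  have : Nonempty X := ⟨0⟩
  let z := hc.fixedPoint Φ
  have hz : Φ z = z := hc.fixedPoint_isFixedPt
  refine ⟨ext z, hi _ (hext z), fun t ht => ?_⟩
  have h1 : z ⟨t, ht⟩ = Real.exp (-(K * t)) •
      (y₀ + ∫ s in (0 : ℝ)..t, (A s (ext z s) + b s)) := by
    conv_lhs => rw [← hz]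
    rfl
  have h2 : ext z t = Real.exp (K * t) • z ⟨t, ht⟩ := by
    simp only [ext, projIcc_of_mem hT ht]
  rw [h2, h1, smul_smul, ← Real.exp_add]
  simp

theorem exists_eq_integral_linear_on {E : Type*} [NormedAddCommGroup E] [NormedSpace ℝ E]
    [CompleteSpace E] {T : ℝ} (hT : 0 ≤ T) {A : ℝ → E →L[ℝ] E} {b : ℝ → E} {M : ℝ}
    (hA : AEStronglyMeasurable A (volume.restrict (Icc 0 T)))
    (hM : ∀ᵐ t ∂(volume.restrict (Icc 0 T)), ‖A t‖ ≤ M)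
    (hb : IntegrableOn b (Icc 0 T)) (y₀ : E) :
    ∃ y : ℝ → E, IntervalIntegrable (fun s => A s (y s) + b s) volume 0 T ∧
      ∀ t ∈ Icc 0 T, y t = y₀ + ∫ s in (0 : ℝ)..t, (A s (y s) + b s) := by
  have hA' : AEStronglyMeasurable ((Icc 0 T).indicator A) volume :=
    (aestronglyMeasurable_indicator_iff measurableSet_Icc).2 hA
  -- The bound `M` may be negative when `T = 0`, hence the maximum with `0` for the extension by
  -- zero.
  have hM' : ∀ᵐ t, ‖(Icc 0 T).indicator A t‖ ≤ max M 0 := by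
    filter_upwards [(ae_restrict_iff' measurableSet_Icc).1 hM] with t ht
    by_cases h : t ∈ Icc 0 T
    · rw [indicator_of_mem h]; exact (ht h).trans (le_max_left _ _)
    · rw [indicator_of_notMem h, norm_zero]; exact le_max_right _ _
  obtain ⟨y, hy, hy'⟩ := exists_eq_integral_linear hT hA' hM'
    (hb.integrable_indicator measurableSet_Icc) y₀
  have heq : ∀ t ∈ Icc 0 T, EqOn
      (fun s => (Icc 0 T).indicator A s (y s) + (Icc 0 T).indicator b s)
      (fun s => A s (y s) + b s) (uIcc 0 t) := by
    intro t ht s hs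
    have hs' : s ∈ Icc 0 T := by
      rw [uIcc_of_le ht.1] at hs
      exact ⟨hs.1, hs.2.trans ht.2⟩
    simp only [indicator_of_mem hs']
  refine ⟨y, (hy 0 T).congr fun s hs => heq T ⟨hT, le_rfl⟩ (uIoc_subset_uIcc hs),
    fun t ht => ?_⟩
  rw [hy' t ht, intervalIntegral.integral_congr (heq t ht)]

theorem exists_eq_integral_linear_backward {E : Type*} [NormedAddCommGroup E] [NormedSpace ℝ E]
    [CompleteSpace E] {T : ℝ} (hT : 0 ≤ T) {A : ℝ → E →L[ℝ] E} {M : ℝ}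
    (hA : AEStronglyMeasurable A (volume.restrict (Icc 0 T)))
    (hM : ∀ᵐ t ∂(volume.restrict (Icc 0 T)), ‖A t‖ ≤ M) (y₀ : E) :
    ∃ y : ℝ → E, IntervalIntegrable (fun s => A s (y s)) volume 0 T ∧
      ∀ t ∈ Icc 0 T, y t = y₀ + ∫ s in t..T, A s (y s) := by
  -- Time reversal turns the terminal value problem into an initial value problem.
  have hmp : MeasurePreserving (fun s => T - s) (volume.restrict (Icc 0 T))
      (volume.restrict (Icc 0 T)) := by
    have := (Measure.measurePreserving_sub_left volume T).restrict_preimage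
      (measurableSet_Icc (a := (0 : ℝ)) (b := T))
    simpa using this
  obtain ⟨y, hy, hy'⟩ := exists_eq_integral_linear_on (b := fun _ => 0) hT
    (hA.comp_measurePreserving hmp) (hmp.quasiMeasurePreserving.ae hM) integrableOn_zero y₀
  simp only [add_zero, Function.comp_apply] at hy hy'
  refine ⟨fun t => y (T - t), ?_, fun t ht => ?_⟩
  · have := (hy.comp_sub_left T).symm
    simpa using this
  · beta_reduce
    rw [hy' (T - t) ⟨by linarith [ht.2], by linarith [ht.1]⟩]
    congr 1
    have := intervalIntegral.integral_comp_sub_left (a := t) (b := T)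
      (fun s => A (T - s) (y s)) T
    simpa using this.symm

/-! ### Averages over families of probability measures -/

/-- Measurable families of probability measures carried by `U`, up to null sets of parameters. -/
structure IsProbabilityFamilyOn {E : Type*} [MeasurableSpace E] (I : Set ℝ) (U : Set E)
    (ν : ℝ → Measure E) : Prop where
  aemeasurable : ∀ B, MeasurableSet B → AEMeasurable (fun t => ν t B) (volume.restrict I)
  prob : ∀ᵐ t ∂(volume.restrict I), IsProbabilityMeasure (ν t)
  compl_eq_zero : ∀ᵐ t ∂(volume.restrict I), ν t Uᶜ = 0

theorem integrable_of_continuousOn_of_compl_eq_zero {E F : Type*} [TopologicalSpace E] [T2Space E]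
    [SecondCountableTopology E] [MeasurableSpace E] [BorelSpace E] [NormedAddCommGroup F]
    {U : Set E} (hU : IsCompact U) {h : E → F} (hh : ContinuousOn h U) {ν : Measure E}
    [IsFiniteMeasure ν] (hν : ν Uᶜ = 0) : Integrable h ν := by
  have hres : ν.restrict U = ν := Measure.restrict_eq_self_of_ae_mem hν
  obtain ⟨C, hC⟩ := (hU.image_of_continuousOn hh).isBounded.exists_norm_le
  rw [← hres]
  have hae : AEStronglyMeasurable h (ν.restrict U) :=
    hh.aestronglyMeasurable_of_isCompact hU hU.measurableSet
  refine Integrable.of_bound hae C ?_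
  filter_upwards [ae_restrict_mem hU.measurableSet] with u hu
  exact hC _ (mem_image_of_mem h hu)

namespace IsProbabilityFamilyOn

variable {E F : Type*} [TopologicalSpace E] [T2Space E]
    [SecondCountableTopology E] [MeasurableSpace E] [BorelSpace E] [NormedAddCommGroup F]
    {I : Set ℝ} {U : Set E} {ν : ℝ → Measure E} {g : ℝ → E → F}

theorem ae_integrable (hν : IsProbabilityFamilyOn I U ν) (hI : IsCompact I) (hU : IsCompact U)
    (hg : ContinuousOn (Function.uncurry g) (I ×ˢ U)) :
    ∀ᵐ t ∂(volume.restrict I), Integrable (g t) (ν t) := by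
  filter_upwards [hν.prob, hν.compl_eq_zero, ae_restrict_mem hI.measurableSet] with t h1 h2 h3
  exact integrable_of_continuousOn_of_compl_eq_zero hU
    (hg.comp (f := fun u => (t, u)) (by fun_prop) fun u hu => ⟨h3, hu⟩) h2

variable [NormedSpace ℝ F]

omit [T2Space E] [SecondCountableTopology E] [BorelSpace E] in
theorem exists_norm_integral_le (hν : IsProbabilityFamilyOn I U ν) (hI : IsCompact I)
    (hU : IsCompact U) (hg : ContinuousOn (Function.uncurry g) (I ×ˢ U)) :
    ∃ C, ∀ᵐ t ∂(volume.restrict I), ‖∫ u, g t u ∂(ν t)‖ ≤ C := by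
  obtain ⟨C, hC⟩ := ((hI.prod hU).image_of_continuousOn hg).isBounded.exists_norm_le
  refine ⟨C, ?_⟩
  filter_upwards [hν.prob, hν.compl_eq_zero, ae_restrict_mem hI.measurableSet] with t h1 h2 h3
  have : ∀ᵐ u ∂(ν t), ‖g t u‖ ≤ C := by
    filter_upwards [measure_eq_zero_iff_ae_notMem.1 h2] with u hu
    exact hC _ ⟨(t, u), ⟨h3, by simpa using hu⟩, rfl⟩
  simpa using norm_integral_le_of_norm_le_const this

theorem aestronglyMeasurable_integral (hν : IsProbabilityFamilyOn I U ν) (hI : IsCompact I)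
    (hU : IsCompact U) (hg : ContinuousOn (Function.uncurry g) (I ×ˢ U)) :
    AEStronglyMeasurable (fun t => ∫ u, g t u ∂(ν t)) (volume.restrict I) :=
  aestronglyMeasurable_integral_of_continuousOn hI hU hg hν.aemeasurable hν.prob hν.compl_eq_zero

theorem integrableOn_integral (hν : IsProbabilityFamilyOn I U ν) (hI : IsCompact I)
    (hU : IsCompact U) (hg : ContinuousOn (Function.uncurry g) (I ×ˢ U)) :
    IntegrableOn (fun t => ∫ u, g t u ∂(ν t)) I := by
  obtain ⟨C, hC⟩ := hν.exists_norm_integral_le hI hU hg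
  have : IsFiniteMeasure (volume.restrict I) := ⟨by simpa using hI.measure_lt_top⟩
  exact Integrable.of_bound (hν.aestronglyMeasurable_integral hI hU hg) C hC

end IsProbabilityFamilyOn

theorem continuousOn_uncurry_of_lipschitz {X Y F : Type*} [NormedAddCommGroup X]
    [NormedAddCommGroup Y] [NormedAddCommGroup F] {I : Set ℝ} {U : Set Y} {L : ℝ}
    {G : ℝ → X → Y → F}
    (hG : ∀ t₁ ∈ I, ∀ t₂ ∈ I, ∀ x₁ x₂, ∀ u₁ ∈ U, ∀ u₂ ∈ U,
      ‖G t₁ x₁ u₁ - G t₂ x₂ u₂‖ ≤ L * (|t₁ - t₂| + ‖x₁ - x₂‖ + ‖u₁ - u₂‖))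
    {x : ℝ → X} (hx : ContinuousOn x I) :
    ContinuousOn (Function.uncurry fun t u => G t (x t) u) (I ×ˢ U) := by
  rintro ⟨t₀, u₀⟩ ⟨ht₀, hu₀⟩
  refine tendsto_iff_norm_sub_tendsto_zero.2 ?_
  have hx' : ContinuousOn (fun q : ℝ × Y => x q.1) (I ×ˢ U) :=
    hx.comp (by fun_prop) fun q hq => hq.1
  have hbd : ContinuousOn (fun q : ℝ × Y =>
      L * (|q.1 - t₀| + ‖x q.1 - x t₀‖ + ‖q.2 - u₀‖)) (I ×ˢ U) :=
    continuousOn_const.mul (((by fun_prop : ContinuousOn (fun q : ℝ × Y => |q.1 - t₀|) _).add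
      (hx'.sub continuousOn_const).norm).add (by fun_prop))
  have hlim := hbd (t₀, u₀) ⟨ht₀, hu₀⟩
  simp only [ContinuousWithinAt, sub_self, abs_zero, norm_zero, add_zero, mul_zero] at hlim
  refine squeeze_zero' (Filter.Eventually.of_forall fun _ => norm_nonneg _) ?_ hlim
  filter_upwards [self_mem_nhdsWithin] with q hq
  exact hG _ hq.1 _ ht₀ _ _ _ hq.2 _ hu₀

theorem continuousOn_of_eq_primitive {E : Type*} [NormedAddCommGroup E] [NormedSpace ℝ E]
    {T : ℝ} (hT : 0 ≤ T) {h H : ℝ → E} {c : E} (hh : IntervalIntegrable h volume 0 T)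
    (hH : ∀ t ∈ Icc 0 T, H t = c + ∫ s in (0 : ℝ)..t, h s) : ContinuousOn H (Icc 0 T) := by
  have := intervalIntegral.continuousOn_primitive_interval' hh left_mem_uIcc
  rw [uIcc_of_le hT] at this
  exact (continuousOn_const.add this).congr hH

/-! ### Relaxed inputs and their variations -/

namespace RelaxedProblem

variable {n m : ℕ} {P : RelaxedProblem n m}
  {μ : ℝ → ProbabilityMeasure (EuclideanSpace ℝ (Fin m))}

theorem IsRelaxedInput.isProbabilityFamilyOn (hμ : P.IsRelaxedInput μ) :
    IsProbabilityFamilyOn (Icc 0 P.T) P.U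
      (fun t => (μ t : Measure (EuclideanSpace ℝ (Fin m)))) where
  aemeasurable := hμ.1
  prob := Filter.Eventually.of_forall fun t => inferInstance
  compl_eq_zero := by
    filter_upwards [hμ.2] with t ht
    exact measure_mono_null (compl_subset_compl.2 ht) Measure.measure_compl_support

/-- `δμ_t + μ_t` is nonnegative of mass one, hence a probability measure equal to its own variation.
Taking `ν_t` to be the variation defines it at every `t`, including the exceptional ones. -/
theorem IsVariation.exists_probabilityFamilyOn
    {δμ : ℝ → SignedMeasure (EuclideanSpace ℝ (Fin m))} (hμ : P.IsRelaxedInput μ)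
    (hδ : P.IsVariation μ δμ) :
    ∃ ν : ℝ → Measure (EuclideanSpace ℝ (Fin m)), IsProbabilityFamilyOn (Icc 0 P.T) P.U ν ∧
      ∀ᵐ t ∂(volume.restrict (Icc 0 P.T)), ∃ _ : IsFiniteMeasure (ν t),
        δμ t = (ν t).toSignedMeasure -
          (μ t : Measure (EuclideanSpace ℝ (Fin m))).toSignedMeasure := by
  let σ := fun t => δμ t + (μ t : Measure (EuclideanSpace ℝ (Fin m))).toSignedMeasure
  have hσ : ∀ᵐ t ∂(volume.restrict (Icc 0 P.T)), ∃ _ : IsFiniteMeasure (σ t).variation,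
      (σ t).variation.toSignedMeasure = σ t ∧ σ t univ = 1 ∧ (σ t).variation.support ⊆ P.U := by
    filter_upwards [hδ.2] with t ht
    obtain ⟨h1, h2, h3⟩ := ht
    have h2' := (VectorMeasure.le_restrict_univ_iff_le _ _).2 h2
    have h4 := SignedMeasure.toMeasureOfZeroLE_toSignedMeasure (σ t) h2'
    have h5 : (σ t).variation = (σ t).toMeasureOfZeroLE univ MeasurableSet.univ h2' := by
      conv_lhs => rw [← h4]
      exact Measure.variation_toSignedMeasure
    have hfin : IsFiniteMeasure (σ t).variation := by rw [h5]; infer_instance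
    refine ⟨hfin, ?_, ?_, h1⟩
    · simp only [h5, h4]
    · simp [σ, h3]
  have hσp : ∀ᵐ t ∂(volume.restrict (Icc 0 P.T)), IsProbabilityMeasure (σ t).variation := by
    filter_upwards [hσ] with t ⟨hfin, h1, h2, _⟩
    rw [← h1, Measure.toSignedMeasure_apply_measurable MeasurableSet.univ] at h2
    exact ⟨by rwa [measureReal_def, ENNReal.toReal_eq_one_iff] at h2⟩
  refine ⟨fun t => (σ t).variation, ⟨fun B hB => ?_, hσp, ?_⟩, ?_⟩
  · have : AEMeasurable (fun t => ENNReal.ofReal (σ t B)) (volume.restrict (Icc 0 P.T)) := by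
      refine ((hδ.1 B hB).add (hμ.1 B hB).ennreal_toReal).ennreal_ofReal.congr ?_
      refine Filter.Eventually.of_forall fun t => ?_
      simp [σ, hB, measureReal_def]
    refine this.congr ?_
    filter_upwards [hσ] with t ⟨hfin, h1, _, _⟩
    rw [← h1, Measure.toSignedMeasure_apply_measurable hB, h1, ofReal_measureReal]
  · filter_upwards [hσ] with t ⟨hfin, h1, h2, h3⟩
    exact measure_mono_null (compl_subset_compl.2 h3) Measure.measure_compl_support
  · filter_upwards [hσ] with t ⟨hfin, h1, h2, h3⟩
    exact ⟨hfin, by rw [h1]; simp [σ]⟩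

theorem isVariation_dirac_sub (hU : IsCompact P.U) (hμ : P.IsRelaxedInput μ)
    {s : ℝ → EuclideanSpace ℝ (Fin m)} (hs : Measurable s) (hsU : ∀ t, s t ∈ P.U) :
    P.IsVariation μ (fun t => (Measure.dirac (s t)).toSignedMeasure -
      (μ t : Measure (EuclideanSpace ℝ (Fin m))).toSignedMeasure) := by
  refine ⟨fun B hB => ?_, Filter.Eventually.of_forall fun t => ⟨?_, ?_, ?_⟩⟩
  · have h1 : Measurable fun t => (Measure.dirac (s t) B).toReal :=
      ((Measure.measurable_coe hB).comp (Measure.measurable_dirac.comp hs)).ennreal_toReal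
    refine (h1.aemeasurable.sub (hμ.1 B hB).ennreal_toReal).congr ?_
    refine Filter.Eventually.of_forall fun t => ?_
    simp [hB, measureReal_def]
  · rw [sub_add_cancel, Measure.variation_toSignedMeasure]
    refine Measure.support_subset_of_isClosed hU.isClosed ?_
    rw [mem_ae_dirac_iff hU.measurableSet]
    exact hsU t
  · rw [sub_add_cancel]
    exact Measure.zero_le_toSignedMeasure _
  · simp

theorem integral_eq_sub_of_eq_sub {E F : Type*} [TopologicalSpace E] [T2Space E]
    [SecondCountableTopology E] [MeasurableSpace E] [BorelSpace E] [NormedAddCommGroup F]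
    [NormedSpace ℝ F] {g : E → F} {μ ν : Measure E} [IsFiniteMeasure μ] [IsFiniteMeasure ν]
    (hν : Integrable g ν) (hμ : Integrable g μ) :
    ∫ᵛ u, g u ∂<•(ν.toSignedMeasure - μ.toSignedMeasure) = ∫ u, g u ∂ν - ∫ u, g u ∂μ := by
  rw [VectorMeasure.integral_sub_vectorMeasure, VectorMeasure.integral_toSignedMeasure,
    VectorMeasure.integral_toSignedMeasure]
  · simpa [VectorMeasure.Integrable] using hν
  · simpa [VectorMeasure.Integrable] using hμ

end RelaxedProblem

/-! ### Costate, duality and attainment of the minimum -/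

namespace RelaxedProblem

variable {n m : ℕ} {P : RelaxedProblem n m}
  {μ : ℝ → ProbabilityMeasure (EuclideanSpace ℝ (Fin m))}
  {x p : ℝ → EuclideanSpace ℝ (Fin n)}

theorem IsTrajectory.continuousOn (hT : 0 ≤ P.T) (hx : P.IsTrajectory μ x) :
    ContinuousOn x (Icc 0 P.T) :=
  continuousOn_of_eq_primitive hT hx.1 hx.2

theorem LipschitzC1.continuousOn_f (hreg : P.LipschitzC1) (hx : ContinuousOn x (Icc 0 P.T)) :
    ContinuousOn (Function.uncurry fun t u => P.f t (x t) u) (Icc 0 P.T ×ˢ P.U) := by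
  obtain ⟨-, -, L, -, -, -, h⟩ := hreg
  exact continuousOn_uncurry_of_lipschitz (fun t₁ h₁ t₂ h₂ x₁ x₂ u₁ hu₁ u₂ hu₂ =>
    (h t₁ h₁ t₂ h₂ x₁ x₂ u₁ hu₁ u₂ hu₂).1) hx

theorem LipschitzC1.continuousOn_dfdx (hreg : P.LipschitzC1) (hx : ContinuousOn x (Icc 0 P.T)) :
    ContinuousOn (Function.uncurry fun t u => P.dfdx t (x t) u) (Icc 0 P.T ×ˢ P.U) := by
  obtain ⟨-, -, L, -, -, -, h⟩ := hreg
  exact continuousOn_uncurry_of_lipschitz (fun t₁ h₁ t₂ h₂ x₁ x₂ u₁ hu₁ u₂ hu₂ =>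
    (h t₁ h₁ t₂ h₂ x₁ x₂ u₁ hu₁ u₂ hu₂).2.1) hx

/-- The adjoint is a continuous linear equivalence, so it commutes with the Bochner integral even
without integrability: both sides are then zero. -/
theorem integral_adjoint_eq {E G : Type*} [NormedAddCommGroup E] [InnerProductSpace ℝ E]
    [CompleteSpace E] [MeasurableSpace G] {ν : Measure G} (B : G → E →L[ℝ] E) :
    ∫ u, ContinuousLinearMap.adjoint (B u) ∂ν = ContinuousLinearMap.adjoint (∫ u, B u ∂ν) := by
  simp only [← ContinuousLinearMap.star_eq_adjoint]
  exact (starL' ℝ (A := E →L[ℝ] E)).integral_comp_comm B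

theorem exists_isCostate (hT : 0 ≤ P.T) (hU : IsCompact P.U) (hreg : P.LipschitzC1)
    (hμ : P.IsRelaxedInput μ) (hx : ContinuousOn x (Icc 0 P.T)) :
    ∃ p : ℝ → EuclideanSpace ℝ (Fin n), P.IsCostate x μ p := by
  have hA : ContinuousOn (Function.uncurry fun t u =>
      ContinuousLinearMap.adjoint (P.dfdx t (x t) u)) (Icc 0 P.T ×ˢ P.U) :=
    ContinuousLinearMap.adjoint.continuous.comp_continuousOn (hreg.continuousOn_dfdx hx)
  have hν := hμ.isProbabilityFamilyOn
  obtain ⟨M, hM⟩ := hν.exists_norm_integral_le isCompact_Icc hU hA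
  exact exists_eq_integral_linear_backward hT
    (hν.aestronglyMeasurable_integral isCompact_Icc hU hA) hM _

/-- Rewrites the terminal value problem as a primitive based at `0`, the form that the product rule
needs. -/
theorem IsCostate.eq_primitive (hT : 0 ≤ P.T) (hp : P.IsCostate x μ p) {t : ℝ}
    (ht : t ∈ Icc 0 P.T) :
    p t = p 0 + ∫ s in (0 : ℝ)..t, -((∫ u, ContinuousLinearMap.adjoint (P.dfdx s (x s) u)
      ∂(μ s : Measure (EuclideanSpace ℝ (Fin m)))) (p s)) := by
  have h := hp.1
  have ht' : t ∈ uIcc 0 P.T := by rwa [uIcc_of_le hT]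
  rw [hp.2 t ht, hp.2 0 ⟨le_rfl, hT⟩, intervalIntegral.integral_neg, add_assoc]
  congr 1
  rw [← intervalIntegral.integral_add_adjacent_intervals
    (h.mono_set (uIcc_subset_uIcc left_mem_uIcc ht'))
    (h.mono_set (uIcc_subset_uIcc ht' right_mem_uIcc))]
  abel

theorem IsCostate.continuousOn (hT : 0 ≤ P.T) (hp : P.IsCostate x μ p) :
    ContinuousOn p (Icc 0 P.T) :=
  continuousOn_of_eq_primitive hT hp.1.neg fun _ ht => hp.eq_primitive hT ht

/-- The costate represents the linearized cost: `∂Ψ/∂x (x T)ᵀ δx T = ∫₀ᵀ H (t, x t, δμ_t, p t) dt`. -/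
theorem linCost_eq_hamCost (hT : 0 ≤ P.T) (hp : P.IsCostate x μ p)
    {δμ : ℝ → SignedMeasure (EuclideanSpace ℝ (Fin m))} {δx : ℝ → EuclideanSpace ℝ (Fin n)}
    (hδ : P.IsLinearizedTrajectory x μ δμ δx) :
    P.linCost x (δx, δμ) = P.hamCost x p δμ := by
  have key := integral_inner_add_inner_of_primitive hT hδ.1 hp.1.neg
    (a := 0) (by simpa using hδ.2) (fun t ht => hp.eq_primitive hT ht)
  have hpT : p P.T = gradient P.Ψ (x P.T) := by
    rw [hp.2 P.T ⟨hT, le_rfl⟩, intervalIntegral.integral_same, add_zero]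
  rw [linCost, hamCost, ← hpT, real_inner_comm]
  rw [inner_zero_left, sub_zero] at key
  rw [← key]
  -- Moving the adjoint across the inner product cancels the two terms in `∂f/∂x` and leaves the
  -- Hamiltonian, at every `t`.
  refine intervalIntegral.integral_congr fun t _ => ?_
  simp only [hamiltonian, Pi.neg_apply]
  rw [integral_adjoint_eq, inner_add_left, inner_neg_right, ContinuousLinearMap.adjoint_inner_right,
    add_neg_cancel_comm]
  exact real_inner_comm _ _

variable {δμ : ℝ → SignedMeasure (EuclideanSpace ℝ (Fin m))}

theorem IsVariation.exists_isLinearizedTrajectory (hT : 0 ≤ P.T) (hU : IsCompact P.U)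
    (hreg : P.LipschitzC1) (hμ : P.IsRelaxedInput μ) (hx : ContinuousOn x (Icc 0 P.T))
    (hδ : P.IsVariation μ δμ) :
    ∃ δx : ℝ → EuclideanSpace ℝ (Fin n), P.IsLinearizedTrajectory x μ δμ δx := by
  have hA := hreg.continuousOn_dfdx hx
  have hf := hreg.continuousOn_f hx
  have hμ' := hμ.isProbabilityFamilyOn
  obtain ⟨ν, hν, hδν⟩ := hδ.exists_probabilityFamilyOn hμ
  obtain ⟨M, hM⟩ := hμ'.exists_norm_integral_le isCompact_Icc hU hA
  have hb : IntegrableOn (fun s => ∫ᵛ u, P.f s (x s) u ∂<•(δμ s)) (Icc 0 P.T) := by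
    refine Integrable.congr ((hν.integrableOn_integral isCompact_Icc hU hf).sub
      (hμ'.integrableOn_integral isCompact_Icc hU hf)) ?_
    filter_upwards [hδν, hν.ae_integrable isCompact_Icc hU hf,
      hμ'.ae_integrable isCompact_Icc hU hf] with t ⟨_, h1⟩ h2 h3
    rw [h1]
    exact (integral_eq_sub_of_eq_sub h2 h3).symm
  obtain ⟨y, hy, hy'⟩ := exists_eq_integral_linear_on hT
    (hμ'.aestronglyMeasurable_integral isCompact_Icc hU hA) hM hb 0
  exact ⟨y, hy, by simpa using hy'⟩

/-- The Hamiltonian along a variation is a difference of averages over probability measures. -/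
theorem hamiltonian_ae_eq (hU : IsCompact P.U) (hreg : P.LipschitzC1) (hμ : P.IsRelaxedInput μ)
    (hx : ContinuousOn x (Icc 0 P.T)) {ν : ℝ → Measure (EuclideanSpace ℝ (Fin m))}
    (hν : IsProbabilityFamilyOn (Icc 0 P.T) P.U ν)
    (hδν : ∀ᵐ t ∂(volume.restrict (Icc 0 P.T)), ∃ _ : IsFiniteMeasure (ν t),
        δμ t = (ν t).toSignedMeasure -
          (μ t : Measure (EuclideanSpace ℝ (Fin m))).toSignedMeasure) :
    ∀ᵐ t ∂(volume.restrict (Icc 0 P.T)), P.hamiltonian t (x t) (δμ t) (p t) =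
      ∫ u, inner ℝ (p t) (P.f t (x t) u) ∂(ν t) -
        ∫ u, inner ℝ (p t) (P.f t (x t) u) ∂(μ t : Measure (EuclideanSpace ℝ (Fin m))) := by
  have hf := hreg.continuousOn_f hx
  filter_upwards [hδν, hν.ae_integrable isCompact_Icc hU hf,
    hμ.isProbabilityFamilyOn.ae_integrable isCompact_Icc hU hf] with t ⟨_, h1⟩ h2 h3
  rw [hamiltonian, h1, integral_eq_sub_of_eq_sub h2 h3, inner_sub_right, integral_inner h2,
    integral_inner h3]

/-- The Hamiltonian can be minimized separately at each time: an average over `ν_t` is at least the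
minimum over `U`, and the Dirac mass at a measurably chosen minimizer reaches it. -/
theorem hamMinimizers_nonempty (hT : 0 ≤ P.T) (hU : IsCompact P.U) (hne : P.U.Nonempty)
    (hreg : P.LipschitzC1) (hμ : P.IsRelaxedInput μ) (hx : ContinuousOn x (Icc 0 P.T))
    (hp : ContinuousOn p (Icc 0 P.T)) : (P.hamMinimizers x μ p).Nonempty := by
  have hf := hreg.continuousOn_f hx
  have hg : ContinuousOn (Function.uncurry fun t u => inner ℝ (p t) (P.f t (x t) u))
      (Icc 0 P.T ×ˢ P.U) :=
    ContinuousOn.inner (hp.comp continuousOn_fst fun _ hq => hq.1) hf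
  obtain ⟨s, hs, hsU, hmin⟩ := exists_measurable_argmin isCompact_Icc hU hne hg
  have hμ' := hμ.isProbabilityFamilyOn
  have hvar := isVariation_dirac_sub hU hμ hs hsU
  -- Comparing integrals of ordered integrands requires both to be integrable.
  have hintegrable : ∀ δμ, P.IsVariation μ δμ →
      IntegrableOn (fun t => P.hamiltonian t (x t) (δμ t) (p t)) (Icc 0 P.T) := by
    intro δμ hδ
    obtain ⟨ν, hν, hδν⟩ := hδ.exists_probabilityFamilyOn hμ
    refine Integrable.congr ((hν.integrableOn_integral isCompact_Icc hU hg).sub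
      (hμ'.integrableOn_integral isCompact_Icc hU hg)) ?_
    filter_upwards [hamiltonian_ae_eq (p := p) hU hreg hμ hx hν hδν] with t ht
    exact ht.symm
  refine ⟨_, hvar, fun δμ hδ => ?_⟩
  obtain ⟨ν, hν, hδν⟩ := IsVariation.exists_probabilityFamilyOn hμ hδ
  simp only [mem_ofPred_eq, hamCost, intervalIntegral.integral_of_le hT,
    ← integral_Icc_eq_integral_Ioc]
  refine integral_mono_ae (hintegrable _ hvar) (hintegrable _ hδ) ?_
  filter_upwards [hamiltonian_ae_eq (p := p) hU hreg hμ hx hν hδν, hν.prob, hν.compl_eq_zero,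
    ae_restrict_mem measurableSet_Icc, hν.ae_integrable isCompact_Icc hU hg,
    hμ'.ae_integrable isCompact_Icc hU hf, hμ'.ae_integrable isCompact_Icc hU hg]
    with t h1 h2 h3 ht h4 h5 h6
  have hdirac : Integrable (P.f t (x t)) (Measure.dirac (s t)) :=
    integrable_dirac (by simp)
  rw [h1, hamiltonian, integral_eq_sub_of_eq_sub hdirac h5, integral_dirac, inner_sub_right,
    integral_inner h5]
  refine sub_le_sub_right ?_ _
  calc inner ℝ (p t) (P.f t (x t) (s t))
      = ∫ _u, inner ℝ (p t) (P.f t (x t) (s t)) ∂(ν t) := by simp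
    _ ≤ _ := by
      refine integral_mono_ae (integrable_const _) h4 ?_
      filter_upwards [measure_eq_zero_iff_ae_notMem.1 h3] with u hu
      exact hmin t ht u (by simpa using hu)

end RelaxedProblem

/-! ### Equivalence of the two optimality functions -/

theorem mainTheorem1 {n m : ℕ} (P : RelaxedProblem n m)
    (hT : 0 < P.T) (hUconn : IsConnected P.U) (hUcomp : IsCompact P.U) (hreg : P.LipschitzC1)
    (μ : ℝ → ProbabilityMeasure (EuclideanSpace ℝ (Fin m))) (hμ : P.IsRelaxedInput μ)
    (x : ℝ → EuclideanSpace ℝ (Fin n)) (hx : P.IsTrajectory μ x) :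
    (∃ p : ℝ → EuclideanSpace ℝ (Fin n), P.IsCostate x μ p) ∧
    ∀ p : ℝ → EuclideanSpace ℝ (Fin n), P.IsCostate x μ p →
      -- both minima are attained
      IsLeast (P.linCost x '' P.linFeasible x μ) (P.thetaL x μ) ∧
      IsLeast (P.hamCost x p '' P.hamFeasible μ) (P.thetaH x μ p) ∧
      -- the values agree
      P.thetaL x μ = P.thetaH x μ p ∧
      -- the minimizing variations agree
      Prod.snd '' P.linMinimizers x μ = P.hamMinimizers x μ p ∧
      ∀ (δx : ℝ → EuclideanSpace ℝ (Fin n))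
        (δμ : ℝ → SignedMeasure (EuclideanSpace ℝ (Fin m))),
        (δx, δμ) ∈ P.linMinimizers x μ ↔
          P.IsLinearizedTrajectory x μ δμ δx ∧ δμ ∈ P.hamMinimizers x μ p := by
  have hxc := hx.continuousOn hT.le
  refine ⟨RelaxedProblem.exists_isCostate hT.le hUcomp hreg hμ hxc, fun p hp => ?_⟩
  have hcost : ∀ z ∈ P.linFeasible x μ, P.linCost x z = P.hamCost x p z.2 := fun z hz =>
    RelaxedProblem.linCost_eq_hamCost hT.le hp hz.2
  -- Forgetting `δx` thus maps the linear feasible set onto the Hamiltonian one; with equal costs,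
  -- this transfers both values and minimizers.
  have hex : ∀ δμ ∈ P.hamFeasible μ, ∃ δx, P.IsLinearizedTrajectory x μ δμ δx := fun δμ hδ =>
    RelaxedProblem.IsVariation.exists_isLinearizedTrajectory hT.le hUcomp hreg hμ hxc hδ
  have himage : P.linCost x '' P.linFeasible x μ = P.hamCost x p '' P.hamFeasible μ := by
    ext c
    constructor
    · rintro ⟨z, hz, rfl⟩
      exact ⟨z.2, hz.1, (hcost z hz).symm⟩
    · rintro ⟨δμ, hδ, rfl⟩
      obtain ⟨δx, hδx⟩ := hex δμ hδ
      exact ⟨(δx, δμ), ⟨hδ, hδx⟩, hcost (δx, δμ) ⟨hδ, hδx⟩⟩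
  have hiff : ∀ (δx : ℝ → EuclideanSpace ℝ (Fin n))
      (δμ : ℝ → SignedMeasure (EuclideanSpace ℝ (Fin m))),
      (δx, δμ) ∈ P.linMinimizers x μ ↔
        P.IsLinearizedTrajectory x μ δμ δx ∧ δμ ∈ P.hamMinimizers x μ p := by
    intro δx δμ
    constructor
    · rintro ⟨hz, hmin⟩
      refine ⟨hz.2, hz.1, fun δν hδν => ?_⟩
      obtain ⟨δy, hδy⟩ := hex δν hδν
      have := hmin (show (δy, δν) ∈ P.linFeasible x μ from ⟨hδν, hδy⟩)
      rwa [mem_ofPred_eq, hcost _ hz, hcost (δy, δν) ⟨hδν, hδy⟩] at this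
    · rintro ⟨hδx, hδ, hmin⟩
      have hz : (δx, δμ) ∈ P.linFeasible x μ := ⟨hδ, hδx⟩
      refine ⟨hz, fun w hw => ?_⟩
      rw [mem_ofPred_eq, hcost _ hz, hcost w hw]
      exact hmin hw.1
  obtain ⟨δμ₀, hδμ₀, hmin₀⟩ := RelaxedProblem.hamMinimizers_nonempty hT.le hUcomp
    hUconn.nonempty hreg hμ hxc (hp.continuousOn hT.le)
  have hleast : IsLeast (P.hamCost x p '' P.hamFeasible μ) (P.hamCost x p δμ₀) :=
    ⟨mem_image_of_mem _ hδμ₀, by rintro _ ⟨δν, hδν, rfl⟩; exact hmin₀ hδν⟩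
  have hH : IsLeast (P.hamCost x p '' P.hamFeasible μ) (P.thetaH x μ p) := by
    rw [RelaxedProblem.thetaH, hleast.csInf_eq]
    exact hleast
  have hLH : P.thetaL x μ = P.thetaH x μ p := by
    rw [RelaxedProblem.thetaL, himage, RelaxedProblem.thetaH]
  refine ⟨by rw [himage, hLH]; exact hH, hH, hLH, ?_, hiff⟩
  ext δμ
  constructor
  · rintro ⟨⟨δx, δν⟩, hz, rfl⟩
    exact ((hiff δx δν).1 hz).2
  · intro hδ
    obtain ⟨δx, hδx⟩ := hex δμ hδ.1
    exact ⟨(δx, δμ), (hiff δx δμ).2 ⟨hδx, hδ⟩, rfl⟩
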